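/- All Lie algebras are over $\mathbb C$. A graded Lie algebra is a Lie algebra $\mathfrak g=\bigoplus_{i\in\mathbb Z}\mathfrak g_i$ with $\dim\mathfrak g_i<\infty$ and $[\mathfrak g_i,\mathfrak g_j]\subset\mathfrak g_{i+j}$, generated by $\mathfrak g_{-1}\oplus\mathfrak g_0\oplus\mathfrak g_1$; an isomorphism of graded Lie algebras is a Lie algebra isomorphism mapping the component of degree $n$ onto the component of degree $n$ for every $n\in\mathbb Z$. A local Lie algebra is a direct sum $\Gamma=\Gamma_{-1}\oplus\Gamma_0\oplus\Gamma_1$ of finite-dimensional spaces with anticommutative bilinear brackets $\Gamma_i\times\Gamma_j\to\Gamma_{i+j}$ for $|i|,|j|,|i+j|\le 1$, satisfying $[x,[y,z]]=[[x,y],z]+[y,[x,z]]$ whenever the three terms are defined. The local part $\Gamma(\mathfrak g)=\mathfrak g_{-1}\oplus\mathfrak g_0\oplus\mathfrak g_1$ of a graded Lie algebra, with the bracket of $\mathfrak g$, is one. For a local Lie algebra $\Gamma$, $\mathfrak g_{max}(\Gamma)$ is the graded Lie algebra freely generated by the local Lie algebra $\Gamma$ (the quotient of the free Lie algebra on $\Gamma$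 by the relations expressing linearity and the brackets of $\Gamma$), and $\mathfrak g_{min}(\Gamma)=\mathfrak g_{max}(\Gamma)/J_{max}$, where $J_{max}$ is the largest graded ideal with $J_{max}\cap\Gamma=\{0\}$. If $\mathfrak g_0$ is a finite-dimensional Lie algebra with a nondegenerate invariant symmetric bilinear form $B_0$, and $V$ is a finite-dimensional $\mathfrak g_0$-module, then $\Gamma(\mathfrak g_0,B_0,V)=V^*\oplus\mathfrak g_0\oplus V$ is the local Lie algebra with components $V^*,\mathfrak g_0,V$ in degrees $-1,0,1$, whose brackets are those of $\mathfrak g_0$, the action on $V$, the contragredient action on $V^*$, and, for $X\in V$, $Y\in V^*$, the element $[X,Y]\in\mathfrak g_0$ with $B_0([X,Y],U)=Y(U.X)$ for all $U\in\mathfrak g_0$. **Proposition.** Let $\mathfrak g=\bigoplus_{i\in\mathbb Z}\mathfrak g_i$ be a finite-dimensional reductive complex Lie algebra which is a graded Lie algebra in the above sense. Let $B$ be a nondegenerate symmetric bilinear form on $\Gamma(\mathfrak g)$ which is invariant, that is, $B([x,y],z)=B(x,[y,z])$ for homogeneous $x,y,z\in\Gamma(\mathfrak g)$ each time that the brackets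 $[x,y]$ and $[y,z]$ are defined in $\Gamma(\mathfrak g)$, and which satisfies $B(\mathfrak g_i,\mathfrak g_j)=0$ when $i+j\ne 0$. Let $B_0$ be the restriction of $B$ to $\mathfrak g_0$. Then: 1. the map $Y\mapsto B(Y,\cdot)$ is an isomorphism of $\mathfrak g_0$-modules from $\mathfrak g_{-1}$ onto the contragredient module $\mathfrak g_1^*$; 2. there are isomorphisms of graded Lie algebras $$\mathfrak g\simeq\mathfrak g_{min}(\Gamma(\mathfrak g))\simeq\mathfrak g_{min}(\Gamma(\mathfrak g_0,B_0,\mathfrak g_1)),$$ where the first one is the identity on $\Gamma(\mathfrak g)$, and the second one is the identity on $\mathfrak g_0$ and on $\mathfrak g_1$ and is $Y\mapsto B(Y,\cdot)$ from $\mathfrak g_{-1}$ to $\mathfrak g_1^*$. -/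

import Mathlib

universe u

noncomputable section

/-! ## Local Lie algebras -/

/-- The three degrees `-1, 0, 1` of a local Lie algebra. -/
inductive LocDeg : Type
  | neg
  | zero
  | pos

namespace LocDeg

instance instDecidableEq : DecidableEq LocDeg := fun a b => by
  cases a <;> cases b <;> first | exact isTrue rfl | exact isFalse (fun h => by cases h)

/-- The degree as an integer. -/
def toInt : LocDeg → ℤ
  | neg => -1
  | zero => 0
  | pos => 1

end LocDeg

/-- A (complex) local Lie algebra `Γ = Γ₋₁ ⊕ Γ₀ ⊕ Γ₁`: finite dimensional spaces, with a bilinear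
bracket `Γᵢ × Γⱼ → Γᵢ₊ⱼ` whenever `i`, `j`, `i + j` are all in `{-1, 0, 1}`, which is anticommutative
and satisfies the Jacobi identity `[x, [y, z]] = [[x, y], z] + [y, [x, z]]` each time its three terms
are defined. -/
structure LocalLieAlgebra where
  carrier : LocDeg → Type u
  [addCommGroup : ∀ i, AddCommGroup (carrier i)]
  [module : ∀ i, Module ℂ (carrier i)]
  [finiteDimensional : ∀ i, FiniteDimensional ℂ (carrier i)]
  bracket : ∀ i j k : LocDeg, i.toInt + j.toInt = k.toInt →
    carrier i →ₗ[ℂ] carrier j →ₗ[ℂ] carrier k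
  anticomm : ∀ (i j k : LocDeg) (h : i.toInt + j.toInt = k.toInt) (h' : j.toInt + i.toInt = k.toInt)
    (x : carrier i) (y : carrier j), bracket i j k h x y = -bracket j i k h' y x
  jacobi : ∀ (i j k ij jk ik l : LocDeg)
    (hij : i.toInt + j.toInt = ij.toInt) (hjk : j.toInt + k.toInt = jk.toInt)
    (hik : i.toInt + k.toInt = ik.toInt) (h₁ : i.toInt + jk.toInt = l.toInt)
    (h₂ : ij.toInt + k.toInt = l.toInt) (h₃ : j.toInt + ik.toInt = l.toInt)
    (x : carrier i) (y : carrier j) (z : carrier k),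
    bracket i jk l h₁ x (bracket j k jk hjk y z) =
      bracket ij k l h₂ (bracket i j ij hij x y) z + bracket j ik l h₃ y (bracket i k ik hik x z)

namespace LocalLieAlgebra

attribute [instance] LocalLieAlgebra.addCommGroup LocalLieAlgebra.module
  LocalLieAlgebra.finiteDimensional

variable (Γ : LocalLieAlgebra.{u})

/-- The underlying vector space `Γ₋₁ ⊕ Γ₀ ⊕ Γ₁`. -/
abbrev Total : Type u := DirectSum LocDeg Γ.carrier

/-- The inclusion of `Γᵢ` in `Γ₋₁ ⊕ Γ₀ ⊕ Γ₁`. -/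
abbrev incl (i : LocDeg) : Γ.carrier i →ₗ[ℂ] Γ.Total := DirectSum.lof ℂ LocDeg Γ.carrier i

/-- `Γ₀` is a Lie algebra. -/
instance instLieRingZero : LieRing (Γ.carrier .zero) where
  bracket x y := Γ.bracket .zero .zero .zero rfl x y
  add_lie x y z := by simp
  lie_add x y z := by simp
  lie_self x := by
    have h := Γ.anticomm .zero .zero .zero rfl rfl x x
    change Γ.bracket .zero .zero .zero rfl x x = 0
    have h2 : (2 : ℂ) • Γ.bracket .zero .zero .zero rfl x x = 0 := by
      rw [two_smul]; exact add_eq_zero_iff_eq_neg.mpr h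
    exact (smul_eq_zero.mp h2).resolve_left two_ne_zero
  leibniz_lie x y z := Γ.jacobi .zero .zero .zero .zero .zero .zero .zero rfl rfl rfl rfl rfl rfl x y z

instance instLieAlgebraZero : LieAlgebra ℂ (Γ.carrier .zero) where
  lie_smul t x y := (Γ.bracket .zero .zero .zero rfl x).map_smul t y

/-- `Γ₁` is a module over `Γ₀` by the bracket. -/
instance instLieRingModulePos : LieRingModule (Γ.carrier .zero) (Γ.carrier .pos) where
  bracket x v := Γ.bracket .zero .pos .pos rfl x v
  add_lie x y v := by simp
  lie_add x v w := by simp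
  leibniz_lie x y v := Γ.jacobi .zero .zero .pos .zero .pos .pos .pos rfl rfl rfl rfl rfl rfl x y v

instance instLieModulePos : LieModule ℂ (Γ.carrier .zero) (Γ.carrier .pos) where
  smul_lie t x v := LinearMap.map_smul₂ (Γ.bracket .zero .pos .pos rfl) t x v
  lie_smul t x v := (Γ.bracket .zero .pos .pos rfl x).map_smul t v

/-! ## The maximal and the minimal graded Lie algebra with a given local part -/

/-- Generators: the elements of `Γ₋₁`, `Γ₀` and `Γ₁`. -/
abbrev Gen : Type u := Σ i : LocDeg, Γ.carrier i

/-- The elements of the free Lie algebra that have to vanish for the three inclusions `Γᵢ → F` to be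
linear and to respect the brackets that are defined in `Γ`. -/
inductive Rel : FreeLieAlgebra ℂ Γ.Gen → Prop
  | add (i : LocDeg) (x y : Γ.carrier i) :
      Rel (FreeLieAlgebra.of ℂ ⟨i, x + y⟩ -
        (FreeLieAlgebra.of ℂ ⟨i, x⟩ + FreeLieAlgebra.of ℂ ⟨i, y⟩))
  | smul (i : LocDeg) (c : ℂ) (x : Γ.carrier i) :
      Rel (FreeLieAlgebra.of ℂ ⟨i, c • x⟩ - c • FreeLieAlgebra.of ℂ ⟨i, x⟩)
  | lie (i j k : LocDeg) (h : i.toInt + j.toInt = k.toInt) (x : Γ.carrier i) (y : Γ.carrier j) :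
      Rel (FreeLieAlgebra.of ℂ ⟨k, Γ.bracket i j k h x y⟩ -
        ⁅(FreeLieAlgebra.of ℂ ⟨i, x⟩ : FreeLieAlgebra ℂ Γ.Gen), FreeLieAlgebra.of ℂ ⟨j, y⟩⁆)

/-- The ideal of relations. -/
def relIdeal : LieIdeal ℂ (FreeLieAlgebra ℂ Γ.Gen) :=
  LieSubmodule.lieSpan ℂ (FreeLieAlgebra ℂ Γ.Gen) {r | Γ.Rel r}

/-- The maximal graded Lie algebra `𝔤_max(Γ)`: the Lie algebra freely generated by the local Lie
algebra `Γ`. -/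
abbrev GMax : Type u := FreeLieAlgebra ℂ Γ.Gen ⧸ Γ.relIdeal

/-- The map from `Γᵢ` to `𝔤_max(Γ)`. -/
def toGMax (i : LocDeg) : Γ.carrier i →ₗ[ℂ] Γ.GMax where
  toFun x := LieSubmodule.Quotient.mk (FreeLieAlgebra.of ℂ (⟨i, x⟩ : Γ.Gen))
  map_add' x y := by
    rw [← sub_eq_zero]
    refine (LieSubmodule.Quotient.mk_eq_zero' (N := Γ.relIdeal)).mpr ?_
    exact LieSubmodule.subset_lieSpan (Rel.add i x y)
  map_smul' c x := by
    rw [← sub_eq_zero]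
    refine (LieSubmodule.Quotient.mk_eq_zero' (N := Γ.relIdeal)).mpr ?_
    exact LieSubmodule.subset_lieSpan (Rel.smul i c x)

/-- Iterated brackets, with any bracketing, of elements of the local part, with their total
degree. -/
inductive IsMonomial : ℤ → Γ.GMax → Prop
  | of (i : LocDeg) (x : Γ.carrier i) : IsMonomial i.toInt (Γ.toGMax i x)
  | lie {m n : ℤ} {x y : Γ.GMax} : IsMonomial m x → IsMonomial n y → IsMonomial (m + n) ⁅x, y⁆

/-- The homogeneous component of degree `n` of `𝔤_max(Γ)`. -/
def gMaxPart (n : ℤ) : Submodule ℂ Γ.GMax := Submodule.span ℂ {x | Γ.IsMonomial n x}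

/-- The local part of `𝔤_max(Γ)`, that is, the image of `Γ`. -/
def gMaxLocal : Submodule ℂ Γ.GMax := ⨆ i : LocDeg, LinearMap.range (Γ.toGMax i)

/-- An ideal of `𝔤_max(Γ)` is graded if each of its elements is a sum of homogeneous elements of
the ideal. -/
def IsGradedIdeal (J : LieIdeal ℂ Γ.GMax) : Prop :=
  J.toSubmodule = ⨆ n : ℤ, J.toSubmodule ⊓ Γ.gMaxPart n

/-- The largest graded ideal `J_max` of `𝔤_max(Γ)` that meets the local part in `0`: the sum of all
of them. -/
def jMax : LieIdeal ℂ Γ.GMax :=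
  sSup {J : LieIdeal ℂ Γ.GMax | Γ.IsGradedIdeal J ∧ J.toSubmodule ⊓ Γ.gMaxLocal = ⊥}

/-- The minimal graded Lie algebra `𝔤_min(Γ) = 𝔤_max(Γ) / J_max`. -/
abbrev GMin : Type u := Γ.GMax ⧸ Γ.jMax

/-- The homogeneous component of degree `n` of `𝔤_min(Γ)`. -/
def gMinPart (n : ℤ) : Submodule ℂ Γ.GMin :=
  (Γ.gMaxPart n).map (LieSubmodule.Quotient.mk' Γ.jMax : Γ.GMax →ₗ[ℂ] Γ.GMin)

/-- The map from `Γᵢ` to `𝔤_min(Γ)`. -/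
def toGMin (i : LocDeg) : Γ.carrier i →ₗ[ℂ] Γ.GMin :=
  (LieSubmodule.Quotient.mk' Γ.jMax : Γ.GMax →ₗ[ℂ] Γ.GMin) ∘ₗ Γ.toGMax i

end LocalLieAlgebra

/-! ## Quadratic Lie algebras and the local Lie algebra of a fundamental triplet -/

/-- A nondegenerate invariant symmetric bilinear form on a Lie algebra. -/
structure QuadraticStructure (L : Type u) [LieRing L] [LieAlgebra ℂ L] where
  form : LinearMap.BilinForm ℂ L
  nondegenerate : form.Nondegenerate
  symm : ∀ x y, form x y = form y x
  invariant : ∀ x y z, form ⁅x, y⁆ z = form x ⁅y, z⁆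

namespace Triplet

variable (L V : Type u) [LieRing L] [LieAlgebra ℂ L]
  [AddCommGroup V] [Module ℂ V] [LieRingModule L V] [LieModule ℂ L V]

/-- The components of `V* ⊕ L ⊕ V`. -/
def Carrier : LocDeg → Type u
  | .neg => Module.Dual ℂ V
  | .zero => L
  | .pos => V

instance instAddCommGroup : ∀ i, AddCommGroup (Carrier L V i)
  | .neg => inferInstanceAs (AddCommGroup (Module.Dual ℂ V))
  | .zero => inferInstanceAs (AddCommGroup L)
  | .pos => inferInstanceAs (AddCommGroup V)

instance instModule : ∀ i, Module ℂ (Carrier L V i)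
  | .neg => inferInstanceAs (Module ℂ (Module.Dual ℂ V))
  | .zero => inferInstanceAs (Module ℂ L)
  | .pos => inferInstanceAs (Module ℂ V)

instance instFiniteDimensional [FiniteDimensional ℂ L] [FiniteDimensional ℂ V] :
    ∀ i, FiniteDimensional ℂ (Carrier L V i)
  | .neg => inferInstanceAs (FiniteDimensional ℂ (Module.Dual ℂ V))
  | .zero => inferInstanceAs (FiniteDimensional ℂ L)
  | .pos => inferInstanceAs (FiniteDimensional ℂ V)

/-- The action of `L` on a module `M`, as a bilinear map. -/
def action (M : Type u) [AddCommGroup M] [Module ℂ M] [LieRingModule L M] [LieModule ℂ L M] :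
    L →ₗ[ℂ] M →ₗ[ℂ] M :=
  (LieModule.toEnd ℂ L M : L →ₗ[ℂ] Module.End ℂ M)

variable {L V}

/-- The linear form `U ↦ Y (U.X)` on `L`, for `X` in `V` and `Y` in `V*`. -/
def orbitForm : V →ₗ[ℂ] Module.Dual ℂ V →ₗ[ℂ] Module.Dual ℂ L :=
  LinearMap.mk₂ ℂ (fun X Y => Y ∘ₗ (action L V).flip X)
    (fun _ _ _ => by ext; simp) (fun _ _ _ => by ext; simp)
    (fun _ _ _ => by ext; simp) (fun _ _ _ => by ext; simp)

/-- The bracket `[X, Y]` in `L` of `X` in `V` and `Y` in `V*`: the element with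
`B₀([X, Y], U) = Y (U.X)` for all `U` in `L`. -/
def pairing [FiniteDimensional ℂ L] (B₀ : QuadraticStructure L) : V →ₗ[ℂ] Module.Dual ℂ V →ₗ[ℂ] L :=
  (orbitForm (L := L) (V := V)).compr₂
    ((LinearMap.BilinForm.toDual B₀.form B₀.nondegenerate).symm : Module.Dual ℂ L →ₗ[ℂ] L)

lemma form_pairing [FiniteDimensional ℂ L] (B₀ : QuadraticStructure L) (X : V) (Y : Module.Dual ℂ V) (U : L) :
    B₀.form (pairing B₀ X Y) U = Y ⁅U, X⁆ := by
  simp [pairing, orbitForm, action]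

lemma pairing_equivariant [FiniteDimensional ℂ L] (B₀ : QuadraticStructure L) (U : L) (X : V) (Y : Module.Dual ℂ V) :
    ⁅U, pairing B₀ X Y⁆ = pairing B₀ ⁅U, X⁆ Y + pairing B₀ X ⁅U, Y⁆ := by
  have key : ∀ W, B₀.form ⁅U, pairing B₀ X Y⁆ W =
      B₀.form (pairing B₀ ⁅U, X⁆ Y + pairing B₀ X ⁅U, Y⁆) W := by
    intro W
    rw [← lie_skew, map_neg, LinearMap.neg_apply, B₀.invariant, map_add, LinearMap.add_apply,
      form_pairing, form_pairing, form_pairing, Module.Dual.lie_apply, lie_lie, map_sub]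
    ring
  have h := B₀.nondegenerate.1 (⁅U, pairing B₀ X Y⁆ - (pairing B₀ ⁅U, X⁆ Y + pairing B₀ X ⁅U, Y⁆))
    (fun W => by rw [map_sub, LinearMap.sub_apply, key W, sub_self])
  exact sub_eq_zero.mp h

/-- The bracket of `V* ⊕ L ⊕ V`: bracket of `L`, action on `V`, contragredient action on `V*`, and
the bracket of `V` with `V*` above. The last line is never reached with `i + j = k`. -/
def bracket [FiniteDimensional ℂ L] (B₀ : QuadraticStructure L) : ∀ i j k : LocDeg, i.toInt + j.toInt = k.toInt →
    Carrier L V i →ₗ[ℂ] Carrier L V j →ₗ[ℂ] Carrier L V k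
  | .zero, .zero, .zero, _ => (action L L : L →ₗ[ℂ] L →ₗ[ℂ] L)
  | .zero, .pos, .pos, _ => (action L V : L →ₗ[ℂ] V →ₗ[ℂ] V)
  | .pos, .zero, .pos, _ => (-(action L V).flip : V →ₗ[ℂ] L →ₗ[ℂ] V)
  | .zero, .neg, .neg, _ =>
    (action L (Module.Dual ℂ V) : L →ₗ[ℂ] Module.Dual ℂ V →ₗ[ℂ] Module.Dual ℂ V)
  | .neg, .zero, .neg, _ =>
    (-(action L (Module.Dual ℂ V)).flip : Module.Dual ℂ V →ₗ[ℂ] L →ₗ[ℂ] Module.Dual ℂ V)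
  | .pos, .neg, .zero, _ => (pairing B₀ : V →ₗ[ℂ] Module.Dual ℂ V →ₗ[ℂ] L)
  | .neg, .pos, .zero, _ => (-(pairing B₀).flip : Module.Dual ℂ V →ₗ[ℂ] V →ₗ[ℂ] L)
  | _, _, _, _ => 0

lemma bracket_anticomm [FiniteDimensional ℂ L] (B₀ : QuadraticStructure L) (i j k : LocDeg)
    (h : i.toInt + j.toInt = k.toInt) (h' : j.toInt + i.toInt = k.toInt)
    (x : Carrier L V i) (y : Carrier L V j) :
    bracket B₀ i j k h x y = -bracket B₀ j i k h' y x := by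
  cases i <;> cases j <;> cases k <;> first
    | exact absurd h (by decide)
    | exact (lie_skew (L := L) x y).symm
    | exact rfl
    | exact (neg_neg _).symm

/-- The three orderings of the Jacobi identity for two elements of `L` and one of a module. -/
lemma jacobi_module {M : Type u} [AddCommGroup M] [Module ℂ M] [LieRingModule L M]
    [LieModule ℂ L M] (x y : L) (m : M) :
    ⁅x, ⁅y, m⁆⁆ = ⁅⁅x, y⁆, m⁆ + ⁅y, ⁅x, m⁆⁆ ∧
    ⁅x, -⁅y, m⁆⁆ = -⁅y, ⁅x, m⁆⁆ + -⁅⁅x, y⁆, m⁆ ∧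
    -⁅⁅x, y⁆, m⁆ = -⁅y, -⁅x, m⁆⁆ + ⁅x, -⁅y, m⁆⁆ := by
  refine ⟨leibniz_lie x y m, ?_, ?_⟩ <;> rw [lie_lie] <;> simp <;> abel

/-- The six orderings of the Jacobi identity for `U` in `L`, `X` in `V` and `Y` in `V*`. -/
lemma jacobi_pairing [FiniteDimensional ℂ L] (B₀ : QuadraticStructure L) (U : L) (X : V) (Y : Module.Dual ℂ V) :
    ⁅U, pairing B₀ X Y⁆ = pairing B₀ ⁅U, X⁆ Y + pairing B₀ X ⁅U, Y⁆ ∧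
    ⁅U, -pairing B₀ X Y⁆ = -pairing B₀ X ⁅U, Y⁆ + -pairing B₀ ⁅U, X⁆ Y ∧
    pairing B₀ X ⁅U, Y⁆ = pairing B₀ (-⁅U, X⁆) Y + ⁅U, pairing B₀ X Y⁆ ∧
    pairing B₀ X (-⁅U, Y⁆) = ⁅pairing B₀ X Y, U⁆ + -pairing B₀ (-⁅U, X⁆) Y ∧
    -pairing B₀ ⁅U, X⁆ Y = -pairing B₀ X (-⁅U, Y⁆) + ⁅U, -pairing B₀ X Y⁆ ∧
    -pairing B₀ (-⁅U, X⁆) Y = ⁅-pairing B₀ X Y, U⁆ + pairing B₀ X (-⁅U, Y⁆) := by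
  have h := pairing_equivariant B₀ U X Y
  have h' : ⁅pairing B₀ X Y, U⁆ = -⁅U, pairing B₀ X Y⁆ := (lie_skew _ _).symm
  refine ⟨h, ?_, ?_, ?_, ?_, ?_⟩ <;> simp [h, h']

lemma bracket_jacobi [FiniteDimensional ℂ L] (B₀ : QuadraticStructure L) (i j k ij jk ik l : LocDeg)
    (hij : i.toInt + j.toInt = ij.toInt) (hjk : j.toInt + k.toInt = jk.toInt)
    (hik : i.toInt + k.toInt = ik.toInt) (h₁ : i.toInt + jk.toInt = l.toInt)
    (h₂ : ij.toInt + k.toInt = l.toInt) (h₃ : j.toInt + ik.toInt = l.toInt)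
    (x : Carrier L V i) (y : Carrier L V j) (z : Carrier L V k) :
    bracket B₀ i jk l h₁ x (bracket B₀ j k jk hjk y z) =
      bracket B₀ ij k l h₂ (bracket B₀ i j ij hij x y) z +
        bracket B₀ j ik l h₃ y (bracket B₀ i k ik hik x z) := by
  cases i <;> cases j <;> cases ij <;> try exact absurd hij (by decide)
  all_goals cases k <;> cases jk <;> try exact absurd hjk (by decide)
  all_goals cases ik <;> try exact absurd hik (by decide)
  all_goals cases l <;> try exact absurd h₁ (by decide)
  · exact (jacobi_module (L := L) (M := Module.Dual ℂ V) y z x).2.2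
  · exact (jacobi_pairing (V := V) B₀ y z x).2.2.2.2.1
  · exact (jacobi_pairing (V := V) B₀ z y x).2.2.2.2.2
  · exact (jacobi_module (L := L) (M := Module.Dual ℂ V) x z y).2.1
  · exact (jacobi_pairing (V := V) B₀ x z y).2.1
  · exact (jacobi_module (L := L) (M := Module.Dual ℂ V) x y z).1
  · exact (jacobi_module (L := L) (M := L) x y z).1
  · exact (jacobi_module (L := L) (M := V) x y z).1
  · exact (jacobi_pairing (V := V) B₀ x y z).1
  · exact (jacobi_module (L := L) (M := V) x z y).2.1
  · exact (jacobi_pairing (V := V) B₀ z x y).2.2.2.1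
  · exact (jacobi_pairing (V := V) B₀ y x z).2.2.1
  · exact (jacobi_module (L := L) (M := V) y z x).2.2

end Triplet

/-- The local Lie algebra `Γ(L, B₀, V) = V* ⊕ L ⊕ V` of a quadratic Lie algebra `(L, B₀)` and a
finite dimensional representation `V` of `L`. -/
def LocalLieAlgebra.ofTriplet (L : Type u) [LieRing L] [LieAlgebra ℂ L] [FiniteDimensional ℂ L]
    (B₀ : QuadraticStructure L) (V : Type u) [AddCommGroup V] [Module ℂ V] [FiniteDimensional ℂ V]
    [LieRingModule L V] [LieModule ℂ L V] : LocalLieAlgebra.{u} where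
  carrier := Triplet.Carrier L V
  bracket := Triplet.bracket B₀
  anticomm := Triplet.bracket_anticomm B₀
  jacobi := Triplet.bracket_jacobi B₀

/-! ## Forms on local Lie algebras -/

namespace LocalLieAlgebra

variable (Γ : LocalLieAlgebra.{u})

/-- A nondegenerate invariant symmetric bilinear form on `Γ` for which `Γᵢ` and `Γⱼ` are orthogonal
when `i + j ≠ 0`. Invariance is `B([x, y], z) = B(x, [y, z])` each time the brackets are
defined. -/
structure QuadraticForm where
  form : LinearMap.BilinForm ℂ Γ.Total
  nondegenerate : form.Nondegenerate
  symm : ∀ x y, form x y = form y x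
  invariant : ∀ (i j k ij jk : LocDeg) (hij : i.toInt + j.toInt = ij.toInt)
    (hjk : j.toInt + k.toInt = jk.toInt)
    (x : Γ.carrier i) (y : Γ.carrier j) (z : Γ.carrier k),
    form (Γ.incl ij (Γ.bracket i j ij hij x y)) (Γ.incl k z) =
      form (Γ.incl i x) (Γ.incl jk (Γ.bracket j k jk hjk y z))
  orthogonal : ∀ (i j : LocDeg), i.toInt + j.toInt ≠ 0 →
    ∀ (x : Γ.carrier i) (y : Γ.carrier j), form (Γ.incl i x) (Γ.incl j y) = 0

namespace QuadraticForm

variable {Γ} (B : Γ.QuadraticForm)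

/-- The restriction of the form to `Γ₀`, which makes `Γ₀` a quadratic Lie algebra. -/
def restrictZero : QuadraticStructure (Γ.carrier .zero) where
  form := B.form.compl₁₂ (Γ.incl .zero) (Γ.incl .zero)
  nondegenerate := by
    have hs : ∀ x y, B.form.compl₁₂ (Γ.incl .zero) (Γ.incl .zero) x y =
        B.form.compl₁₂ (Γ.incl .zero) (Γ.incl .zero) y x := fun x y => B.symm _ _
    have h : ∀ x, (∀ y, B.form.compl₁₂ (Γ.incl .zero) (Γ.incl .zero) x y = 0) → x = 0 := by
      intro x hx
      have h0 : Γ.incl .zero x = 0 := by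
        refine B.nondegenerate.1 _ (fun t => ?_)
        induction t using DirectSum.induction_on with
        | zero => simp
        | of i y =>
          cases i with
          | zero => exact hx y
          | neg => exact B.orthogonal .zero .neg (by decide) x y
          | pos => exact B.orthogonal .zero .pos (by decide) x y
        | add a b ha hb => rw [map_add, ha, hb, add_zero]
      exact DirectSum.of_injective (β := Γ.carrier) LocDeg.zero
        (h0.trans (map_zero _).symm)
    exact ⟨h, fun y hy => h y (fun x => (hs y x).trans (hy x))⟩
  symm x y := B.symm _ _
  invariant x y z := B.invariant .zero .zero .zero .zero .zero rfl rfl x y z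

/-- The map `Y ↦ B(Y, ·)` from `Γ₋₁` to the dual of `Γ₁`. -/
def toDualPos : Γ.carrier .neg →ₗ[ℂ] Module.Dual ℂ (Γ.carrier .pos) :=
  B.form.compl₁₂ (Γ.incl .neg) (Γ.incl .pos)

/-- The local Lie algebra `Γ(Γ₀, B₀, Γ₁)`, where `B₀` is the restriction of the form to `Γ₀`. -/
abbrev tripletAlgebra : LocalLieAlgebra.{u} :=
  LocalLieAlgebra.ofTriplet (Γ.carrier .zero) B.restrictZero (Γ.carrier .pos)

end QuadraticForm

end LocalLieAlgebra

/-! ## Graded Lie algebras -/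

/-- A graded Lie algebra: a direct sum of finite dimensional subspaces `𝒢 i`, `i ∈ ℤ`, with
`[𝒢 i, 𝒢 j] ⊆ 𝒢 (i + j)`, generated by `𝒢 (-1) ⊕ 𝒢 0 ⊕ 𝒢 1`. -/
structure IsGradedLieAlgebra {𝔤 : Type u} [LieRing 𝔤] [LieAlgebra ℂ 𝔤]
    (𝒢 : ℤ → Submodule ℂ 𝔤) : Prop where
  isInternal : DirectSum.IsInternal 𝒢
  finiteDimensional : ∀ i, FiniteDimensional ℂ (𝒢 i)
  lie_mem : ∀ (i j : ℤ) (x y : 𝔤), x ∈ 𝒢 i → y ∈ 𝒢 j → ⁅x, y⁆ ∈ 𝒢 (i + j)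
  generated : LieSubalgebra.lieSpan ℂ 𝔤 ((𝒢 (-1) ⊔ 𝒢 0 ⊔ 𝒢 1 : Submodule ℂ 𝔤) : Set 𝔤) = ⊤

/-- The local part `Γ(𝔤)` of a graded Lie algebra, as a local Lie algebra. -/
def IsGradedLieAlgebra.localPart {𝔤 : Type u} [LieRing 𝔤] [LieAlgebra ℂ 𝔤]
    {𝒢 : ℤ → Submodule ℂ 𝔤} (h𝒢 : IsGradedLieAlgebra 𝒢) : LocalLieAlgebra.{u} where
  carrier i := 𝒢 i.toInt
  finiteDimensional i := h𝒢.finiteDimensional i.toInt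
  bracket _ _ _ h := LinearMap.mk₂ ℂ
    (fun x y => ⟨⁅(x : 𝔤), (y : 𝔤)⁆, h ▸ h𝒢.lie_mem _ _ _ _ x.2 y.2⟩)
    (fun x x' y => Subtype.ext (add_lie (x : 𝔤) (x' : 𝔤) (y : 𝔤)))
    (fun c x y => Subtype.ext (smul_lie c (x : 𝔤) (y : 𝔤)))
    (fun x y y' => Subtype.ext (lie_add (x : 𝔤) (y : 𝔤) (y' : 𝔤)))
    (fun c x y => Subtype.ext (lie_smul c (x : 𝔤) (y : 𝔤)))
  anticomm _ _ _ _ _ x y := Subtype.ext (lie_skew (x : 𝔤) (y : 𝔤)).symm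
  jacobi _ _ _ _ _ _ _ _ _ _ _ _ _ x y z :=
    Subtype.ext (leibniz_lie (x : 𝔤) (y : 𝔤) (z : 𝔤))

/-- A Lie algebra isomorphism that maps each homogeneous component onto the one of the same
degree. -/
def IsGradedEquiv {𝔤 𝔥 : Type u} [LieRing 𝔤] [LieAlgebra ℂ 𝔤] [LieRing 𝔥] [LieAlgebra ℂ 𝔥]
    (𝒢 : ℤ → Submodule ℂ 𝔤) (ℋ : ℤ → Submodule ℂ 𝔥) (e : 𝔤 ≃ₗ⁅ℂ⁆ 𝔥) : Prop :=
  ∀ n, (𝒢 n).map (e.toLinearEquiv : 𝔤 →ₗ[ℂ] 𝔥) = ℋ n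

end

noncomputable section

/-! ## Graded ideals of a reductive graded Lie algebra -/

section Reductive

open LieAlgebra

variable {𝔤 : Type u} [LieRing 𝔤] [LieAlgebra ℂ 𝔤]

/-! Both isomorphisms are instances of `LocalIdent.exists_equiv_gMin`: once a local Lie algebra `Γ`
is identified with the local part of the reductive algebra `𝔤`, the induced morphism `lift` from
`GMax` to `𝔤` is onto and its kernel is `jMax`. This is applied to the local part itself and to the
triplet algebra. The latter is identified with the local part through `Y ↦ B(Y, ·)`: nondegeneracy
of `B` makes this map bijective, and invariance makes it respect brackets.

The kernel of `lift` is graded and meets `Γ` in zero, so it lies in `jMax`. Conversely, let `J` be a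
graded ideal of `GMax` that meets `Γ` in zero. The components of degrees -1, 0, 1 of `GMax` are no
larger than `Γ` (`gMaxPart_le_range_toGMax`), so `J` lives in degrees `|n| ≥ 2`, where every element
is a sum of brackets. Its image in `𝔤` is therefore a graded ideal inside `[𝔤, 𝔤]` without component
of degree 0.

Such an ideal vanishes (`ideal_eq_bot`). On `[𝔤, 𝔤]` the degree derivation is `ad H` for some `H`,
so `ad H` acts on the degree `n` part of the ideal by the nonzero scalar `n`. Invariance of the
Killing form then makes the ideal orthogonal first to `H`, then to all of `𝔤`. Hence it is central,
`ad H` kills it, and it is zero. -/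

/-- If the radical is central, then a derivation differs from an inner one by a map to the
center. -/
lemma exists_derivation_sub_ad_mem_center [FiniteDimensional ℂ 𝔤] [HasCentralRadical ℂ 𝔤]
    (D : 𝔤 →ₗ[ℂ] 𝔤) (hD : ∀ a b, D ⁅a, b⁆ = ⁅D a, b⁆ + ⁅a, D b⁆) :
    ∃ H : 𝔤, ∀ x, D x - ⁅H, x⁆ ∈ center ℂ 𝔤 := by
  have hker : ∀ x : 𝔤, killingForm ℂ 𝔤 x = 0 → x ∈ center ℂ 𝔤 := by
    intro x hx
    rw [← HasCentralRadical.radical_eq_center]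
    refine killingCompl_top_le_radical ℂ 𝔤 ?_
    rw [LieIdeal.mem_killingCompl]
    intro y _
    rw [LieModule.traceForm_comm, hx, LinearMap.zero_apply]
  -- The form `y ↦ tr(D ∘ ad y)` kills the kernel of the Killing form, which is central. It is
  -- therefore represented by some `H` through the Killing form, although that form may be
  -- degenerate.
  let t : Module.Dual ℂ 𝔤 :=
    LinearMap.trace ℂ 𝔤 ∘ₗ LinearMap.mulLeft ℂ (D : Module.End ℂ 𝔤) ∘ₗ
      (ad ℂ 𝔤 : 𝔤 →ₗ[ℂ] Module.End ℂ 𝔤)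
  have ht : t ∈ (LinearMap.ker (killingForm ℂ 𝔤)).dualAnnihilator := by
    rw [Submodule.mem_dualAnnihilator]
    intro x hx
    have h0 : ad ℂ 𝔤 x = 0 := by
      ext z
      rw [ad_apply, ← lie_skew, (LieModule.mem_maxTrivSubmodule ℂ 𝔤 𝔤 x).mp (hker x hx) z]
      simp
    simp [t, h0]
  rw [← LinearMap.range_dualMap_eq_dualAnnihilator_ker] at ht
  obtain ⟨ξ, hξ⟩ := ht
  obtain ⟨H, rfl⟩ := (Module.evalEquiv ℂ 𝔤).surjective ξ
  have hH : ∀ y, LinearMap.trace ℂ 𝔤 (ad ℂ 𝔤 H * ad ℂ 𝔤 y) =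
      LinearMap.trace ℂ 𝔤 (D * ad ℂ 𝔤 y) := by
    intro y
    have h := LinearMap.congr_fun hξ y
    rw [LinearMap.trace_mul_comm]
    exact h
  refine ⟨H, fun x => hker _ (LinearMap.ext fun y => ?_)⟩
  have hDx : ad ℂ 𝔤 (D x) = D * ad ℂ 𝔤 x - ad ℂ 𝔤 x * D := by
    ext z
    simp [hD]
  have hHx : ad ℂ 𝔤 ⁅H, x⁆ = ad ℂ 𝔤 H * ad ℂ 𝔤 x - ad ℂ 𝔤 x * ad ℂ 𝔤 H := by
    ext z
    simp
  have hxy : ad ℂ 𝔤 ⁅x, y⁆ = ad ℂ 𝔤 x * ad ℂ 𝔤 y - ad ℂ 𝔤 y * ad ℂ 𝔤 x := by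
    ext z
    simp
  -- By cyclicity of the trace, the Killing form of `D x - [H, x]` and `y` is `tr((D - ad H) ∘ ad
  -- [x, y])`, which is zero by the choice of `H`.
  have key := hH ⁅x, y⁆
  have cyc : ∀ T : Module.End ℂ 𝔤, LinearMap.trace ℂ 𝔤 ((T * ad ℂ 𝔤 x - ad ℂ 𝔤 x * T) * ad ℂ 𝔤 y) =
      LinearMap.trace ℂ 𝔤 (T * ad ℂ 𝔤 ⁅x, y⁆) := by
    intro T
    rw [hxy, sub_mul, mul_sub, map_sub, map_sub, mul_assoc, mul_assoc,
      LinearMap.trace_mul_comm ℂ (ad ℂ 𝔤 x), mul_assoc]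
  rw [map_sub, LinearMap.sub_apply, LinearMap.zero_apply, killingForm_apply_apply,
    killingForm_apply_apply, hDx, hHx, ← Module.End.mul_eq_comp, ← Module.End.mul_eq_comp,
    cyc, cyc, key, sub_self]

/-- The degree derivation of a graded Lie algebra. -/
lemma IsGradedLieAlgebra.exists_degree_derivation {𝒢 : ℤ → Submodule ℂ 𝔤}
    (h𝒢 : IsGradedLieAlgebra 𝒢) :
    ∃ D : 𝔤 →ₗ[ℂ] 𝔤, (∀ n, ∀ x ∈ 𝒢 n, D x = (n : ℂ) • x) ∧
      ∀ a b, D ⁅a, b⁆ = ⁅D a, b⁆ + ⁅a, D b⁆ := by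
  let e := LinearEquiv.ofBijective (DirectSum.coeLinearMap 𝒢) h𝒢.isInternal
  let D : 𝔤 →ₗ[ℂ] 𝔤 :=
    DirectSum.toModule ℂ ℤ 𝔤 (fun n => (n : ℂ) • (𝒢 n).subtype) ∘ₗ (e.symm : 𝔤 →ₗ[ℂ] _)
  have hD : ∀ n, ∀ x ∈ 𝒢 n, D x = (n : ℂ) • x := by
    intro n x hx
    have : e.symm x = DirectSum.lof ℂ ℤ (fun n => 𝒢 n) n ⟨x, hx⟩ := by
      rw [LinearEquiv.symm_apply_eq]
      exact (DirectSum.coeLinearMap_lof 𝒢 n ⟨x, hx⟩).symm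
    simp [D, this]
  refine ⟨D, hD, fun a b => ?_⟩
  have htop : ∀ x : 𝔤, x ∈ ⨆ n, 𝒢 n := fun x => by
    rw [h𝒢.isInternal.submodule_iSup_eq_top]; trivial
  induction htop a using Submodule.iSup_induction' with
  | zero => simp
  | add a a' _ _ h h' => rw [add_lie, map_add, h, h', map_add, add_lie, add_lie]; abel
  | mem m a ha =>
    induction htop b using Submodule.iSup_induction' with
    | zero => simp
    | add b b' _ _ h h' => rw [lie_add, map_add, h, h', map_add, lie_add, lie_add]; abel
    | mem n b hb =>
      rw [hD m a ha, hD n b hb, hD _ _ (h𝒢.lie_mem m n a b ha hb), smul_lie, lie_smul, ← add_smul]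
      push_cast
      rfl

/-- In a reductive graded Lie algebra, a graded ideal that is contained in the derived algebra and
has no component of degree `0` vanishes. -/
lemma IsGradedLieAlgebra.ideal_eq_bot [FiniteDimensional ℂ 𝔤] [HasCentralRadical ℂ 𝔤]
    {𝒢 : ℤ → Submodule ℂ 𝔤} (h𝒢 : IsGradedLieAlgebra 𝒢) (J : LieIdeal ℂ 𝔤)
    (hJ : J.toSubmodule ≤ ⨆ n, J.toSubmodule ⊓ 𝒢 n) (hJ0 : ∀ x ∈ J, x ∈ 𝒢 0 → x = 0)
    (hJd : J.toSubmodule ≤ Submodule.span ℂ {z | ∃ a b : 𝔤, ⁅a, b⁆ = z}) : J = ⊥ := by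
  obtain ⟨D, hD, hDl⟩ := h𝒢.exists_degree_derivation
  obtain ⟨H, hH⟩ := exists_derivation_sub_ad_mem_center D hDl
  have hc : ∀ x y : 𝔤, ⁅D x - ⁅H, x⁆, y⁆ = 0 := fun x y => by
    rw [← lie_skew, (LieModule.mem_maxTrivSubmodule ℂ 𝔤 𝔤 _).mp (hH x) y, neg_zero]
  -- Central errors disappear inside brackets, so `D` and `ad H` agree on the derived algebra. They
  -- may differ on the center, whence the hypothesis `hJd`.
  have hDH : ∀ x ∈ J, D x = ⁅H, x⁆ := by
    intro x hx
    have hx' := hJd hx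
    clear hx
    induction hx' using Submodule.span_induction with
    | zero => simp
    | add a b _ _ h h' => rw [map_add, h, h', lie_add]
    | smul c a _ h => rw [map_smul, h, lie_smul]
    | mem z hz =>
      obtain ⟨a, b, rfl⟩ := hz
      have h1 := hc a b
      have h2 := hc b a
      rw [sub_lie, sub_eq_zero] at h1 h2
      rw [hDl, h1, ← lie_skew a (D b), h2, lie_skew a, ← leibniz_lie]
  have hJn : ∀ n, ∀ x ∈ J, x ∈ 𝒢 n → ⁅H, x⁆ = (n : ℂ) • x := fun n x hx hn => by
    rw [← hDH x hx, hD n x hn]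
  have hne : ∀ n, ∀ x ∈ J, x ∈ 𝒢 n → x ≠ 0 → (n : ℂ) ≠ 0 := by
    rintro n x hx hn h0 h
    obtain rfl : n = 0 := by exact_mod_cast h
    exact h0 (hJ0 x hx hn)
  have homog : ∀ S : Submodule ℂ 𝔤, (∀ n, ∀ x ∈ J, x ∈ 𝒢 n → x ≠ 0 → x ∈ S) →
      J.toSubmodule ≤ S := by
    refine fun S h => hJ.trans (iSup_le fun n x hx => ?_)
    by_cases h0 : x = 0
    · exact h0 ▸ S.zero_mem
    · exact h n x hx.1 hx.2 h0
  -- With `κ` the Killing form, `0 = κ([H, H], x) = κ(H, [H, x]) = n κ(H, x)` and `n ≠ 0`.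
  have hHJ : ∀ x ∈ J, killingForm ℂ 𝔤 H x = 0 := by
    refine homog (LinearMap.ker (killingForm ℂ 𝔤 H)) fun n x hx hn h0 => ?_
    have h : killingForm ℂ 𝔤 ⁅H, H⁆ x = killingForm ℂ 𝔤 H ⁅H, x⁆ :=
      LieModule.traceForm_apply_lie_apply ℂ 𝔤 𝔤 H H x
    rw [hJn n x hx hn, lie_self, map_zero, LinearMap.zero_apply, map_smul, smul_eq_mul] at h
    exact (mul_eq_zero.mp h.symm).resolve_left (hne n x hx hn h0)
  -- Here `n κ(x, y) = κ([H, x], y) = κ(H, [x, y])`, which is zero since `[x, y]` is again in `J`.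
  have hcen : J ≤ center ℂ 𝔤 := by
    rw [← HasCentralRadical.radical_eq_center]
    refine le_trans ?_ (killingCompl_top_le_radical ℂ 𝔤)
    refine homog (LieIdeal.killingCompl ℂ 𝔤 ⊤).toSubmodule fun n x hx hn h0 => ?_
    refine (LieIdeal.mem_killingCompl ℂ 𝔤 ⊤).mpr fun y _ => ?_
    rw [LieModule.traceForm_comm]
    have h : killingForm ℂ 𝔤 ⁅H, x⁆ y = killingForm ℂ 𝔤 H ⁅x, y⁆ :=
      LieModule.traceForm_apply_lie_apply ℂ 𝔤 𝔤 H x y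
    rw [hJn n x hx hn, hHJ _ (lie_mem_left ℂ 𝔤 J x y hx), map_smul, LinearMap.smul_apply,
      smul_eq_mul] at h
    exact (mul_eq_zero.mp h).resolve_left (hne n x hx hn h0)
  rw [eq_bot_iff]
  refine homog ⊥ fun n x hx hn h0 => absurd ?_ h0
  have h := hJn n x hx hn
  rw [(LieModule.mem_maxTrivSubmodule ℂ 𝔤 𝔤 x).mp (hcen hx) H] at h
  exact (smul_eq_zero.mp h.symm).resolve_left (hne n x hx hn h0)

end Reductive

/-! ## The homogeneous components of the maximal graded Lie algebra -/

namespace LocalLieAlgebra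

variable (Γ : LocalLieAlgebra.{u})

lemma toGMax_bracket (i j k : LocDeg) (h : i.toInt + j.toInt = k.toInt) (x : Γ.carrier i)
    (y : Γ.carrier j) :
    ⁅Γ.toGMax i x, Γ.toGMax j y⁆ = Γ.toGMax k (Γ.bracket i j k h x y) := by
  symm
  rw [← sub_eq_zero]
  refine (LieSubmodule.Quotient.mk_eq_zero' (N := Γ.relIdeal)).mpr ?_
  exact LieSubmodule.subset_lieSpan (Rel.lie i j k h x y)

/-- The span of the brackets of `k + 1` elements of `Γᵢ`. -/
def iterLie (i : LocDeg) : ℕ → Submodule ℂ Γ.GMax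
  | 0 => LinearMap.range (Γ.toGMax i)
  | k + 1 => Submodule.span ℂ {z | ∃ x, ∃ y ∈ iterLie i k, ⁅Γ.toGMax i x, y⁆ = z}

lemma lie_mem_iterLie_succ (i : LocDeg) (k : ℕ) (x : Γ.carrier i) {y : Γ.GMax}
    (hy : y ∈ Γ.iterLie i k) : ⁅Γ.toGMax i x, y⁆ ∈ Γ.iterLie i (k + 1) :=
  Submodule.subset_span ⟨x, y, hy, rfl⟩

lemma iterLie_succ_induction {i : LocDeg} {k : ℕ} {T : Γ.GMax →ₗ[ℂ] Γ.GMax}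
    {S : Submodule ℂ Γ.GMax} (h : ∀ x, ∀ y ∈ Γ.iterLie i k, T ⁅Γ.toGMax i x, y⁆ ∈ S)
    {z : Γ.GMax} (hz : z ∈ Γ.iterLie i (k + 1)) : T z ∈ S := by
  have : Γ.iterLie i (k + 1) ≤ S.comap T := by
    refine Submodule.span_le.mpr ?_
    rintro _ ⟨x, y, hy, rfl⟩
    exact h x y hy
  exact this hz

lemma zero_lie_mem_iterLie (i : LocDeg) (k : ℕ) (u : Γ.carrier .zero) {y : Γ.GMax}
    (hy : y ∈ Γ.iterLie i k) : ⁅Γ.toGMax .zero u, y⁆ ∈ Γ.iterLie i k := by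
  have h0 : LocDeg.zero.toInt + i.toInt = i.toInt := zero_add _
  induction k generalizing y with
  | zero =>
    obtain ⟨x, rfl⟩ := hy
    rw [Γ.toGMax_bracket .zero i i h0]
    exact ⟨_, rfl⟩
  | succ k ih =>
    refine Γ.iterLie_succ_induction (T := LieModule.toEnd ℂ Γ.GMax Γ.GMax (Γ.toGMax .zero u))
      (fun x y hy => ?_) hy
    rw [LieModule.toEnd_apply_apply, leibniz_lie, Γ.toGMax_bracket .zero i i h0]
    exact add_mem (Γ.lie_mem_iterLie_succ i k _ hy) (Γ.lie_mem_iterLie_succ i k x (ih hy))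

/-- The Jacobi identity moves `x` past the leading factor `x'`: the term with `[x, x']` is an action
of `Γ₀`, and the other term is shorter by one, so induction applies. The base case ends with an
action of `Γ₀` on `Γⱼ` in both terms. -/
lemma opposite_lie_mem_iterLie {i j : LocDeg} (hij : i.toInt + j.toInt = 0) (x : Γ.carrier i)
    {k : ℕ} {y : Γ.GMax} (hy : y ∈ Γ.iterLie j (k + 1)) :
    ⁅Γ.toGMax i x, y⁆ ∈ Γ.iterLie j k := by
  have hi0 : LocDeg.zero.toInt + j.toInt = j.toInt := zero_add _
  induction k generalizing y with
  | zero =>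
    refine Γ.iterLie_succ_induction (T := LieModule.toEnd ℂ Γ.GMax Γ.GMax (Γ.toGMax i x))
      (fun x' y hy => ?_) hy
    obtain ⟨y, rfl⟩ := hy
    rw [LieModule.toEnd_apply_apply, leibniz_lie, Γ.toGMax_bracket i j .zero hij,
      Γ.toGMax_bracket i j .zero hij]
    refine add_mem (Γ.zero_lie_mem_iterLie j 0 _ ⟨y, rfl⟩) ?_
    rw [← lie_skew]
    exact neg_mem (Γ.zero_lie_mem_iterLie j 0 _ ⟨x', rfl⟩)
  | succ k ih =>
    refine Γ.iterLie_succ_induction (T := LieModule.toEnd ℂ Γ.GMax Γ.GMax (Γ.toGMax i x))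
      (fun x' y hy => ?_) hy
    rw [LieModule.toEnd_apply_apply, leibniz_lie, Γ.toGMax_bracket i j .zero hij]
    exact add_mem (Γ.zero_lie_mem_iterLie j _ _ hy) (Γ.lie_mem_iterLie_succ j k x' (ih hy))

/-- The candidates for the homogeneous components. -/
def component : ℤ → Submodule ℂ Γ.GMax
  | .ofNat 0 => LinearMap.range (Γ.toGMax .zero)
  | .ofNat (k + 1) => Γ.iterLie .pos k
  | .negSucc k => Γ.iterLie .neg k

lemma range_toGMax_eq_component (i : LocDeg) :
    LinearMap.range (Γ.toGMax i) = Γ.component i.toInt := by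
  cases i <;> rfl

lemma toGMax_lie_mem_component (i : LocDeg) (x : Γ.carrier i) (n : ℤ) {y : Γ.GMax}
    (hy : y ∈ Γ.component n) : ⁅Γ.toGMax i x, y⁆ ∈ Γ.component (i.toInt + n) := by
  match n, hy with
  | .ofNat 0, hy =>
    obtain ⟨u, rfl⟩ := hy
    have hi : i.toInt + LocDeg.zero.toInt = i.toInt := add_zero _
    rw [Γ.toGMax_bracket i .zero i hi]
    change _ ∈ Γ.component (i.toInt + LocDeg.zero.toInt)
    rw [hi, ← range_toGMax_eq_component]
    exact ⟨_, rfl⟩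
  | .ofNat (k + 1), hy =>
    cases i with
    | zero =>
      rw [show LocDeg.zero.toInt + Int.ofNat (k + 1) = Int.ofNat (k + 1) from zero_add _]
      exact Γ.zero_lie_mem_iterLie .pos k x hy
    | pos =>
      rw [show LocDeg.pos.toInt + Int.ofNat (k + 1) = Int.ofNat (k + 1 + 1) from add_comm _ _]
      exact Γ.lie_mem_iterLie_succ .pos k x hy
    | neg =>
      rw [show LocDeg.neg.toInt + Int.ofNat (k + 1) = Int.ofNat k by
        simp [LocDeg.toInt]]
      -- For `k = 0` the bracket leaves `iterLie` and falls into the image of `Γ₀`; the same split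
      -- occurs below in negative degrees.
      cases k with
      | zero =>
        obtain ⟨y, rfl⟩ := hy
        exact ⟨_, (Γ.toGMax_bracket .neg .pos .zero rfl x y).symm⟩
      | succ k => exact Γ.opposite_lie_mem_iterLie rfl x hy
  | .negSucc k, hy =>
    cases i with
    | zero =>
      rw [show LocDeg.zero.toInt + Int.negSucc k = Int.negSucc k from zero_add _]
      exact Γ.zero_lie_mem_iterLie .neg k x hy
    | neg =>
      rw [show LocDeg.neg.toInt + Int.negSucc k = Int.negSucc (k + 1) by
        simp only [LocDeg.toInt]; omega]
      exact Γ.lie_mem_iterLie_succ .neg k x hy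
    | pos =>
      cases k with
      | zero =>
        obtain ⟨y, rfl⟩ := hy
        exact ⟨_, (Γ.toGMax_bracket .pos .neg .zero rfl x y).symm⟩
      | succ k =>
        rw [show LocDeg.pos.toInt + Int.negSucc (k + 1) = Int.negSucc k by
          simp only [LocDeg.toInt]; omega]
        exact Γ.opposite_lie_mem_iterLie rfl x hy

/-- The adjoint action of a bracket is the commutator of the actions, so the case of generators
propagates to all bracketings. -/
lemma IsMonomial.lie_mem_component {Γ : LocalLieAlgebra.{u}} {m : ℤ} {x : Γ.GMax}
    (hx : Γ.IsMonomial m x) (n : ℤ) {y : Γ.GMax} (hy : y ∈ Γ.component n) :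
    ⁅x, y⁆ ∈ Γ.component (m + n) := by
  induction hx generalizing n y with
  | of i x => exact Γ.toGMax_lie_mem_component i x n hy
  | @lie m m' a b _ _ ha hb =>
    rw [lie_lie]
    refine sub_mem ?_ ?_
    · rw [add_assoc]; exact ha _ (hb _ hy)
    · rw [add_comm m, add_assoc]; exact hb _ (ha _ hy)

lemma IsMonomial.mem_component {Γ : LocalLieAlgebra.{u}} {m : ℤ} {x : Γ.GMax}
    (hx : Γ.IsMonomial m x) : x ∈ Γ.component m := by
  induction hx with
  | of i x => rw [← range_toGMax_eq_component]; exact ⟨x, rfl⟩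
  | lie ha _ _ hb => exact ha.lie_mem_component _ hb

/-- The local part of `𝔤_max(Γ)` is the image of `Γ`. -/
lemma gMaxPart_le_range_toGMax (i : LocDeg) :
    Γ.gMaxPart i.toInt ≤ LinearMap.range (Γ.toGMax i) := by
  rw [range_toGMax_eq_component]
  exact Submodule.span_le.mpr fun x hx => IsMonomial.mem_component hx

/-- A monomial whose degree is not -1, 0 or 1 cannot be a generator. This places the images of the
ideals in the derived algebra of `𝔤`. -/
lemma gMaxPart_le_span_lie {n : ℤ} (hn : ∀ i : LocDeg, i.toInt ≠ n) :
    Γ.gMaxPart n ≤ Submodule.span ℂ {z | ∃ a b : Γ.GMax, ⁅a, b⁆ = z} := by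
  refine Submodule.span_mono fun x hx => ?_
  cases hx with
  | of i x => exact absurd rfl (hn i)
  | lie _ _ => exact ⟨_, _, rfl⟩

/-- The universal property gives a morphism from the free Lie algebra to the subalgebra `S`.
Followed by the inclusion, it agrees with the quotient map on generators, hence everywhere. -/
lemma lieSpan_range_toGMax :
    LieSubalgebra.lieSpan ℂ Γ.GMax {z | ∃ i x, Γ.toGMax i x = z} = ⊤ := by
  let S := LieSubalgebra.lieSpan ℂ Γ.GMax {z | ∃ i x, Γ.toGMax i x = z}
  let mk : FreeLieAlgebra ℂ Γ.Gen →ₗ⁅ℂ⁆ Γ.GMax :=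
    { (LieSubmodule.Quotient.mk' Γ.relIdeal : FreeLieAlgebra ℂ Γ.Gen →ₗ[ℂ] Γ.GMax) with
      map_lie' := rfl }
  let l : FreeLieAlgebra ℂ Γ.Gen →ₗ⁅ℂ⁆ S :=
    FreeLieAlgebra.lift ℂ fun p => ⟨Γ.toGMax p.1 p.2, LieSubalgebra.subset_lieSpan ⟨p.1, p.2, rfl⟩⟩
  have h : S.incl.comp l = mk := by
    refine FreeLieAlgebra.hom_ext fun p => ?_
    rw [LieHom.comp_apply, FreeLieAlgebra.lift_of_apply]
    rfl
  rw [eq_top_iff]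
  rintro x -
  obtain ⟨y, rfl⟩ := LieSubmodule.Quotient.surjective_mk' Γ.relIdeal x
  have : mk y ∈ S := by rw [← h]; exact (l y).2
  exact this

/-- The sum of the components is a subalgebra that contains the generators. Independence of these
components is never needed: that of the `𝒢 n` replaces it. -/
lemma iSup_gMaxPart : ⨆ n, Γ.gMaxPart n = ⊤ := by
  have hmon : ∀ n x, Γ.IsMonomial n x → x ∈ ⨆ n, Γ.gMaxPart n := fun n x hx =>
    Submodule.mem_iSup_of_mem n (Submodule.subset_span hx)
  have hlie : ∀ x ∈ ⨆ n, Γ.gMaxPart n, ∀ y ∈ ⨆ n, Γ.gMaxPart n, ⁅x, y⁆ ∈ ⨆ n, Γ.gMaxPart n := by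
    intro x hx y hy
    induction hx using Submodule.iSup_induction' with
    | zero => simp
    | add a b _ _ ha hb => rw [add_lie]; exact add_mem ha hb
    | mem m x hx =>
      induction hy using Submodule.iSup_induction' with
      | zero => simp
      | add a b _ _ ha hb => rw [lie_add]; exact add_mem ha hb
      | mem n y hy =>
        induction hx using Submodule.span_induction with
        | zero => simp
        | add a b _ _ ha hb => rw [add_lie]; exact add_mem ha hb
        | smul c a _ ha => rw [smul_lie]; exact Submodule.smul_mem _ c ha
        | mem x hx =>
          induction hy using Submodule.span_induction with
          | zero => simp
          | add a b _ _ ha hb => rw [lie_add]; exact add_mem ha hb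
          | smul c a _ ha => rw [lie_smul]; exact Submodule.smul_mem _ c ha
          | mem y hy => exact hmon _ _ (hx.lie hy)
  let S : LieSubalgebra ℂ Γ.GMax := { (⨆ n, Γ.gMaxPart n) with lie_mem' := fun hx hy => hlie _ hx _ hy }
  have hS : (⊤ : LieSubalgebra ℂ Γ.GMax) ≤ S := by
    rw [← lieSpan_range_toGMax, LieSubalgebra.lieSpan_le]
    rintro _ ⟨i, x, rfl⟩
    exact hmon _ _ (.of i x)
  exact eq_top_iff.mpr fun x _ => hS (LieSubalgebra.mem_top (R := ℂ) x)

end LocalLieAlgebra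

/-! ## Graded Lie algebras with a given local part -/

/-- An identification of a local Lie algebra with the local part of a graded Lie algebra. -/
structure LocalIdent (Γ : LocalLieAlgebra.{u}) {𝔤 : Type u} [LieRing 𝔤] [LieAlgebra ℂ 𝔤]
    (𝒢 : ℤ → Submodule ℂ 𝔤) where
  toLin : ∀ i, Γ.carrier i →ₗ[ℂ] 𝔤
  injective : ∀ i, Function.Injective (toLin i)
  range_eq : ∀ i, LinearMap.range (toLin i) = 𝒢 i.toInt
  map_bracket : ∀ i j k h x y, toLin k (Γ.bracket i j k h x y) = ⁅toLin i x, toLin j y⁆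

namespace LocalIdent

variable {Γ : LocalLieAlgebra.{u}} {𝔤 : Type u} [LieRing 𝔤] [LieAlgebra ℂ 𝔤]
  {𝒢 : ℤ → Submodule ℂ 𝔤} (f : LocalIdent Γ 𝒢)

lemma toLin_mem (i : LocDeg) (x : Γ.carrier i) : f.toLin i x ∈ 𝒢 i.toInt :=
  f.range_eq i ▸ LinearMap.mem_range_self _ x

/-- The morphism from the free Lie algebra on the generators. -/
def freeLift : FreeLieAlgebra ℂ Γ.Gen →ₗ⁅ℂ⁆ 𝔤 :=
  FreeLieAlgebra.lift ℂ fun p => f.toLin p.1 p.2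

@[simp] lemma freeLift_of (i : LocDeg) (x : Γ.carrier i) :
    f.freeLift (FreeLieAlgebra.of ℂ ⟨i, x⟩) = f.toLin i x :=
  FreeLieAlgebra.lift_of_apply _ _

lemma relIdeal_le_ker : Γ.relIdeal ≤ f.freeLift.ker := by
  refine LieSubmodule.lieSpan_le.mpr fun r hr => ?_
  change r ∈ f.freeLift.ker
  rw [LieHom.mem_ker]
  cases hr with
  | add i x y => simp
  | smul i c x => simp
  | lie i j k h x y => simp [f.map_bracket]

/-- The morphism from the maximal graded Lie algebra. -/
def lift : Γ.GMax →ₗ⁅ℂ⁆ 𝔤 :=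
  { Γ.relIdeal.toSubmodule.liftQ (f.freeLift : FreeLieAlgebra ℂ Γ.Gen →ₗ[ℂ] 𝔤)
      f.relIdeal_le_ker with
    map_lie' := fun {x y} => by
      obtain ⟨x, rfl⟩ := LieSubmodule.Quotient.surjective_mk' Γ.relIdeal x
      obtain ⟨y, rfl⟩ := LieSubmodule.Quotient.surjective_mk' Γ.relIdeal y
      exact f.freeLift.map_lie x y }

@[simp] lemma lift_toGMax (i : LocDeg) (x : Γ.carrier i) : f.lift (Γ.toGMax i x) = f.toLin i x :=
  f.freeLift_of i x

lemma lift_surjective (h𝒢 : IsGradedLieAlgebra 𝒢) : Function.Surjective f.lift := by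
  rw [← LieHom.range_eq_top, eq_top_iff, ← h𝒢.generated, LieSubalgebra.lieSpan_le]
  have h : ∀ i : LocDeg, 𝒢 i.toInt ≤ f.lift.range.toSubmodule := fun i => by
    rw [← f.range_eq i]
    rintro _ ⟨x, rfl⟩
    exact ⟨Γ.toGMax i x, f.lift_toGMax i x⟩
  exact sup_le (sup_le (h .neg) (h .zero)) (h .pos)

lemma lift_mem (h𝒢 : IsGradedLieAlgebra 𝒢) {n : ℤ} {x : Γ.GMax} (hx : x ∈ Γ.gMaxPart n) :
    f.lift x ∈ 𝒢 n := by
  have : Γ.gMaxPart n ≤ (𝒢 n).comap (f.lift : Γ.GMax →ₗ[ℂ] 𝔤) := by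
    refine Submodule.span_le.mpr fun x hmon => ?_
    change f.lift x ∈ 𝒢 n
    clear hx
    induction hmon with
    | of i x => rw [lift_toGMax]; exact f.toLin_mem i x
    | lie _ _ ha hb => rw [LieHom.map_lie]; exact h𝒢.lie_mem _ _ _ _ ha hb
  exact this hx

/-- The images lie in the independent subspaces `𝒢 n` and together span `𝔤`, so none of the
inclusions can be strict. -/
lemma map_gMaxPart (h𝒢 : IsGradedLieAlgebra 𝒢) (n : ℤ) :
    (Γ.gMaxPart n).map (f.lift : Γ.GMax →ₗ[ℂ] 𝔤) = 𝒢 n := by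
  have hle : ∀ n, (Γ.gMaxPart n).map (f.lift : Γ.GMax →ₗ[ℂ] 𝔤) ≤ 𝒢 n := by
    rintro n _ ⟨x, hx, rfl⟩
    exact f.lift_mem h𝒢 hx
  have htop : ⨆ n, (Γ.gMaxPart n).map (f.lift : Γ.GMax →ₗ[ℂ] 𝔤) = ⊤ := by
    rw [← Submodule.map_iSup, Γ.iSup_gMaxPart, Submodule.map_top, LinearMap.range_eq_top]
    exact f.lift_surjective h𝒢
  refine le_antisymm (hle n) fun x hx => ?_
  have hx' : x ∈ (Γ.gMaxPart n).map (f.lift : Γ.GMax →ₗ[ℂ] 𝔤) ⊔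
      ⨆ (m) (_ : m ≠ n), (Γ.gMaxPart m).map (f.lift : Γ.GMax →ₗ[ℂ] 𝔤) := by
    have h : (⊤ : Submodule ℂ 𝔤) ≤ _ := htop.symm.le.trans
      (iSup_split_single (fun n => (Γ.gMaxPart n).map (f.lift : Γ.GMax →ₗ[ℂ] 𝔤)) n).le
    exact h trivial
  obtain ⟨y, hy, z, hz, rfl⟩ := Submodule.mem_sup.mp hx'
  have hz' : z ∈ 𝒢 n := by simpa using sub_mem hx (hle n hy)
  have hz0 : z = 0 := Submodule.disjoint_def.mp (h𝒢.isInternal.submodule_iSupIndep n) z hz'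
    (iSup₂_mono (fun m _ => hle m) hz)
  rw [hz0, add_zero]
  exact hy

lemma eq_zero_of_mem_gMaxLocal (h𝒢 : IsGradedLieAlgebra 𝒢) {x : Γ.GMax} (hx : x ∈ Γ.gMaxLocal)
    (h0 : f.lift x = 0) : x = 0 := by
  obtain ⟨c, hc⟩ : ∃ c : ∀ i, Γ.carrier i,
      x = Γ.toGMax .neg (c .neg) + Γ.toGMax .zero (c .zero) + Γ.toGMax .pos (c .pos) := by
    refine Submodule.iSup_induction (motive := fun x => ∃ c : ∀ i, Γ.carrier i,
      x = Γ.toGMax .neg (c .neg) + Γ.toGMax .zero (c .zero) + Γ.toGMax .pos (c .pos)) _ hx (fun i y hy => ?_) ⟨0, by simp⟩ ?_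
    · obtain ⟨y, rfl⟩ := hy
      refine ⟨Pi.single i y, ?_⟩
      cases i <;> simp
    · rintro _ _ ⟨c, rfl⟩ ⟨c', rfl⟩
      refine ⟨c + c', ?_⟩
      simp only [Pi.add_apply, map_add]
      abel
  have hind := iSupIndep_iff_finsetSum_eq_zero_imp_eq_zero 𝒢 |>.mp
    h𝒢.isInternal.submodule_iSupIndep
  have hz : ∀ i, f.toLin i (c i) = 0 := by
    -- Independence is stated for families indexed by `ℤ`; the value 0 in the other degrees is
    -- irrelevant, as the sum runs over `{-1, 0, 1}`.
    let g : ℤ → 𝔤 := fun n => if n = -1 then f.toLin .neg (c .neg)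
      else if n = 0 then f.toLin .zero (c .zero)
      else if n = 1 then f.toLin .pos (c .pos) else 0
    have hg := hind {-1, 0, 1} g ?_ ?_
    · intro i
      cases i
      · exact hg (-1) (by simp)
      · exact hg 0 (by simp)
      · exact hg 1 (by simp)
    · intro n hn
      simp only [Finset.mem_insert, Finset.mem_singleton] at hn
      rcases hn with rfl | rfl | rfl
      · exact f.toLin_mem .neg _
      · exact f.toLin_mem .zero _
      · exact f.toLin_mem .pos _
    · rw [hc] at h0
      simpa [g, add_assoc] using h0
  have hc0 : ∀ i, c i = 0 := fun i => f.injective i ((hz i).trans (map_zero _).symm)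
  simp [hc, hc0]

/-- The homogeneous terms of an element of the kernel have images in distinct `𝒢 n` with sum zero,
so each term is itself in the kernel. On `Γ` the morphism is injective. -/
lemma ker_le_jMax (h𝒢 : IsGradedLieAlgebra 𝒢) : f.lift.ker ≤ Γ.jMax := by
  refine le_sSup ⟨?_, ?_⟩
  · refine le_antisymm (fun x hx => ?_) (iSup_le fun n => inf_le_left)
    obtain ⟨c, hc, rfl⟩ := (Submodule.mem_iSup_iff_exists_finsupp Γ.gMaxPart x).mp
      (Γ.iSup_gMaxPart ▸ Submodule.mem_top)
    have hind := iSupIndep_iff_finsetSum_eq_zero_imp_eq_zero 𝒢 |>.mp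
      h𝒢.isInternal.submodule_iSupIndep c.support (fun n => f.lift (c n))
      (fun n _ => f.lift_mem h𝒢 (hc n))
    have hx0 : f.lift (c.sum fun _ y => y) = 0 := hx
    rw [Finsupp.sum, map_sum] at hx0
    refine Submodule.sum_mem _ fun n hn => Submodule.mem_iSup_of_mem n ⟨?_, hc n⟩
    exact hind hx0 n hn
  · rw [eq_bot_iff]
    exact fun x hx => f.eq_zero_of_mem_gMaxLocal h𝒢 hx.2 hx.1

lemma jMax_le_ker [FiniteDimensional ℂ 𝔤] [LieAlgebra.HasCentralRadical ℂ 𝔤]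
    (h𝒢 : IsGradedLieAlgebra 𝒢) : Γ.jMax ≤ f.lift.ker := by
  refine sSup_le fun J hJ => ?_
  obtain ⟨hgr, hloc⟩ := hJ
  have hsurj := f.lift_surjective h𝒢
  have hmap : (J.map f.lift).toSubmodule = J.toSubmodule.map (f.lift : Γ.GMax →ₗ[ℂ] 𝔤) :=
    LieIdeal.coe_map_of_surjective hsurj
  have hlocal : ∀ (i : LocDeg) (n : ℤ), i.toInt = n → J.toSubmodule ⊓ Γ.gMaxPart n = ⊥ := by
    rintro i _ rfl
    rw [eq_bot_iff, ← hloc]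
    exact inf_le_inf_left _ ((Γ.gMaxPart_le_range_toGMax i).trans
      (le_iSup (fun i => LinearMap.range (Γ.toGMax i)) i))
  -- Only the degrees other than -1, 0, 1 contribute to the image of `J`.
  have key : ∀ S : Submodule ℂ 𝔤,
      (∀ n, (∀ i : LocDeg, i.toInt ≠ n) → ∀ x ∈ J, x ∈ Γ.gMaxPart n → f.lift x ∈ S) →
      (J.map f.lift).toSubmodule ≤ S := by
    intro S hS
    rw [hmap, Submodule.map_le_iff_le_comap, hgr]
    refine iSup_le fun n => ?_
    by_cases hn : ∀ i : LocDeg, i.toInt ≠ n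
    · exact fun x hx => hS n hn x hx.1 hx.2
    · push Not at hn
      obtain ⟨i, hi⟩ := hn
      rw [hlocal i n hi]
      exact bot_le
  rw [← LieIdeal.map_eq_bot_iff]
  refine h𝒢.ideal_eq_bot _ (key _ fun n _ x hx hn => ?_) (fun x hx hx0 => ?_)
    (key _ fun n hn x _ hx => ?_)
  · exact Submodule.mem_iSup_of_mem n ⟨LieIdeal.mem_map hx, f.lift_mem h𝒢 hn⟩
  -- The image of `J` lies in the sum of the `𝒢 n` with `n ≠ 0`, which is disjoint from `𝒢 0`.
  · refine Submodule.disjoint_def.mp (h𝒢.isInternal.submodule_iSupIndep 0) x hx0 ?_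
    refine key _ (fun n hn y _ hy => ?_) hx
    exact Submodule.mem_iSup_of_mem n (Submodule.mem_iSup_of_mem (hn .zero).symm (f.lift_mem h𝒢 hy))
  · have h : Γ.gMaxPart n ≤ (Submodule.span ℂ {z | ∃ a b : 𝔤, ⁅a, b⁆ = z}).comap
        (f.lift : Γ.GMax →ₗ[ℂ] 𝔤) := by
      refine (Γ.gMaxPart_le_span_lie hn).trans (Submodule.span_le.mpr ?_)
      rintro _ ⟨a, b, rfl⟩
      exact Submodule.subset_span ⟨f.lift a, f.lift b, (f.lift.map_lie a b).symm⟩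
    exact h hx

/-- A reductive graded Lie algebra is the minimal graded Lie algebra of its local part. -/
theorem exists_equiv_gMin [FiniteDimensional ℂ 𝔤] [LieAlgebra.HasCentralRadical ℂ 𝔤]
    (h𝒢 : IsGradedLieAlgebra 𝒢) :
    ∃ e : 𝔤 ≃ₗ⁅ℂ⁆ Γ.GMin, IsGradedEquiv 𝒢 Γ.gMinPart e ∧
      ∀ i x, e (f.toLin i x) = Γ.toGMin i x := by
  have hJ : Γ.jMax = f.lift.ker := le_antisymm (f.jMax_le_ker h𝒢) (f.ker_le_jMax h𝒢)
  let l : Γ.GMin →ₗ[ℂ] 𝔤 :=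
    Γ.jMax.toSubmodule.liftQ (f.lift : Γ.GMax →ₗ[ℂ] 𝔤) (f.jMax_le_ker h𝒢)
  let mk : Γ.GMax →ₗ[ℂ] Γ.GMin := LieSubmodule.Quotient.mk' Γ.jMax
  have hmk : ∀ x, l (mk x) = f.lift x := fun _ => rfl
  have hmks : Function.Surjective mk := LieSubmodule.Quotient.surjective_mk' Γ.jMax
  have hinj : Function.Injective l := by
    rw [← LinearMap.ker_eq_bot, eq_bot_iff]
    intro z hz
    obtain ⟨x, rfl⟩ := hmks z
    have hx : x ∈ Γ.jMax := by
      rw [hJ, LieHom.mem_ker]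
      exact hz
    exact LieSubmodule.Quotient.mk_eq_zero'.mpr hx
  have hsurj : Function.Surjective l := fun y => by
    obtain ⟨x, rfl⟩ := f.lift_surjective h𝒢 y
    exact ⟨mk x, rfl⟩
  let L : Γ.GMin →ₗ⁅ℂ⁆ 𝔤 :=
    { l with
      map_lie' := fun {x y} => by
        obtain ⟨x, rfl⟩ := hmks x
        obtain ⟨y, rfl⟩ := hmks y
        exact f.lift.map_lie x y }
  let e : Γ.GMin ≃ₗ⁅ℂ⁆ 𝔤 := LieEquiv.ofBijective L ⟨hinj, hsurj⟩
  have he : ∀ x, e.symm (f.lift x) = mk x := fun x => e.symm_apply_apply (mk x)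
  refine ⟨e.symm, fun n => ?_, fun i x => ?_⟩
  · rw [← f.map_gMaxPart h𝒢 n, ← Submodule.map_comp]
    exact congrArg (fun T => Submodule.map T (Γ.gMaxPart n)) (LinearMap.ext he)
  · rw [← f.lift_toGMax, he]
    rfl

end LocalIdent

/-! ## The dual of the component of degree one -/

namespace LocalLieAlgebra.QuadraticForm

variable {Γ : LocalLieAlgebra.{u}} (B : Γ.QuadraticForm)

lemma eq_zero_of_form_incl {i j : LocDeg} (hij : ∀ k, k ≠ j → i.toInt + k.toInt ≠ 0)
    (x : Γ.carrier i) (h : ∀ y, B.form (Γ.incl i x) (Γ.incl j y) = 0) : x = 0 := by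
  have h0 : Γ.incl i x = 0 := by
    refine B.nondegenerate.1 _ fun t => ?_
    induction t using DirectSum.induction_on with
    | zero => simp
    | of k y =>
      by_cases hk : k = j
      · subst hk
        exact h y
      · exact B.orthogonal i k (hij k hk) x y
    | add a b ha hb => rw [map_add, ha, hb, add_zero]
  exact DirectSum.of_injective (β := Γ.carrier) i (h0.trans (map_zero _).symm)

lemma toDualPos_apply (Y : Γ.carrier .neg) (X : Γ.carrier .pos) :
    B.toDualPos Y X = B.form (Γ.incl .neg Y) (Γ.incl .pos X) := rfl

lemma toDualPos_injective : Function.Injective B.toDualPos := by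
  rw [← LinearMap.ker_eq_bot, LinearMap.ker_eq_bot']
  exact fun Y hY => B.eq_zero_of_form_incl (j := .pos)
    (fun k hk => by cases k <;> first | exact absurd rfl hk | decide) Y (LinearMap.congr_fun hY)

lemma flip_toDualPos_injective : Function.Injective B.toDualPos.flip := by
  rw [← LinearMap.ker_eq_bot, LinearMap.ker_eq_bot']
  refine fun X hX => B.eq_zero_of_form_incl (j := .neg)
    (fun k hk => by cases k <;> first | exact absurd rfl hk | decide) X fun Y => ?_
  rw [B.symm]
  exact LinearMap.congr_fun hX Y

/-- Injectivity of the map and of its flip bounds the dimensions of `Γ₋₁` and `Γ₁` by each other. -/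
lemma toDualPos_bijective : Function.Bijective B.toDualPos := by
  have h := LinearMap.finrank_le_finrank_of_injective B.toDualPos_injective
  have h' := LinearMap.finrank_le_finrank_of_injective B.flip_toDualPos_injective
  rw [Subspace.dual_finrank_eq] at h h'
  refine ⟨B.toDualPos_injective, ?_⟩
  refine (LinearMap.injective_iff_surjective_of_finrank_eq_finrank ?_).mp B.toDualPos_injective
  rw [Subspace.dual_finrank_eq]
  exact le_antisymm h h'

lemma toDualPos_bracket (U : Γ.carrier .zero) (Y : Γ.carrier .neg) :
    B.toDualPos (Γ.bracket .zero .neg .neg rfl U Y) = ⁅U, B.toDualPos Y⁆ := by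
  ext X
  rw [Module.Dual.lie_apply, toDualPos_apply, toDualPos_apply,
    Γ.anticomm .zero .neg .neg rfl rfl, map_neg, map_neg, LinearMap.neg_apply,
    B.invariant .neg .zero .pos .neg .pos rfl rfl]
  rfl

/-- The isomorphism `Y ↦ B(Y, ·)` of `Γ₋₁` with the dual of `Γ₁`. -/
def dualPosEquiv : Γ.carrier .neg ≃ₗ[ℂ] Module.Dual ℂ (Γ.carrier .pos) :=
  LinearEquiv.ofBijective B.toDualPos B.toDualPos_bijective

lemma toDualPos_symm (Y : Module.Dual ℂ (Γ.carrier .pos)) :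
    B.toDualPos (B.dualPosEquiv.symm Y) = Y :=
  B.dualPosEquiv.apply_symm_apply Y

lemma symm_toDualPos (Y : Γ.carrier .neg) : B.dualPosEquiv.symm (B.toDualPos Y) = Y :=
  B.dualPosEquiv.symm_apply_apply Y

lemma symm_lie (U : Γ.carrier .zero) (Y : Module.Dual ℂ (Γ.carrier .pos)) :
    B.dualPosEquiv.symm ⁅U, Y⁆ = Γ.bracket .zero .neg .neg rfl U (B.dualPosEquiv.symm Y) := by
  apply B.toDualPos_injective
  rw [toDualPos_bracket, toDualPos_symm, toDualPos_symm]

/-- For `y` in `Γ₋₁` corresponding to `Y`, invariance used twice gives `B([X, y], U) = B(X, [y, U])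
= B(y, [U, X]) = Y(U.X)`, the equation that characterizes the pairing. -/
lemma pairing_eq_bracket (X : Γ.carrier .pos) (Y : Module.Dual ℂ (Γ.carrier .pos)) :
    Triplet.pairing B.restrictZero X Y =
      Γ.bracket .pos .neg .zero rfl X (B.dualPosEquiv.symm Y) := by
  rw [← sub_eq_zero]
  refine B.restrictZero.nondegenerate.1 _ fun U => ?_
  rw [map_sub, LinearMap.sub_apply, Triplet.form_pairing, sub_eq_zero]
  change _ = B.form (Γ.incl .zero _) (Γ.incl .zero U)
  rw [B.invariant .pos .neg .zero .zero .neg rfl rfl, B.symm,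
    B.invariant .neg .zero .pos .neg .pos rfl rfl, ← toDualPos_apply, toDualPos_symm]
  rfl

/-- The linear maps from the components of `Γ(Γ₀, B₀, Γ₁)` to those of `Γ`. -/
def ofTripletMap : ∀ i, Triplet.Carrier (Γ.carrier .zero) (Γ.carrier .pos) i ≃ₗ[ℂ] Γ.carrier i
  | .neg => B.dualPosEquiv.symm
  | .zero => LinearEquiv.refl ℂ _
  | .pos => LinearEquiv.refl ℂ _

lemma ofTripletMap_bracket (i j k : LocDeg) (h : i.toInt + j.toInt = k.toInt)
    (x : B.tripletAlgebra.carrier i) (y : B.tripletAlgebra.carrier j) :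
    B.ofTripletMap k (B.tripletAlgebra.bracket i j k h x y) =
      Γ.bracket i j k h (B.ofTripletMap i x) (B.ofTripletMap j y) := by
  -- Anticommutativity on both sides leaves one order of each pair of degrees to check.
  have anti : ∀ {i j k : LocDeg} (h : i.toInt + j.toInt = k.toInt)
      (h' : j.toInt + i.toInt = k.toInt),
      (∀ x y, B.ofTripletMap k (B.tripletAlgebra.bracket i j k h x y) =
        Γ.bracket i j k h (B.ofTripletMap i x) (B.ofTripletMap j y)) →
      ∀ x y, B.ofTripletMap k (B.tripletAlgebra.bracket j i k h' x y) =
        Γ.bracket j i k h' (B.ofTripletMap j x) (B.ofTripletMap i y) := by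
    intro i j k h h' H x y
    rw [B.tripletAlgebra.anticomm j i k h' h, Γ.anticomm j i k h' h, ← H y x]
    exact map_neg (B.ofTripletMap k) _
  have pos_neg : ∀ x y, B.ofTripletMap .zero (B.tripletAlgebra.bracket .pos .neg .zero rfl x y) =
      Γ.bracket .pos .neg .zero rfl (B.ofTripletMap .pos x) (B.ofTripletMap .neg y) :=
    B.pairing_eq_bracket
  have zero_neg : ∀ x y, B.ofTripletMap .neg (B.tripletAlgebra.bracket .zero .neg .neg rfl x y) =
      Γ.bracket .zero .neg .neg rfl (B.ofTripletMap .zero x) (B.ofTripletMap .neg y) :=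
    B.symm_lie
  have zero_pos : ∀ x y, B.ofTripletMap .pos (B.tripletAlgebra.bracket .zero .pos .pos rfl x y) =
      Γ.bracket .zero .pos .pos rfl (B.ofTripletMap .zero x) (B.ofTripletMap .pos y) :=
    fun _ _ => rfl
  cases i <;> cases j <;> cases k <;> first
    | exact absurd h (by decide)
    | exact pos_neg x y
    | exact zero_neg x y
    | exact zero_pos x y
    | exact anti rfl rfl pos_neg x y
    | exact anti rfl rfl zero_neg x y
    | exact anti rfl rfl zero_pos x y
    | rfl

end LocalLieAlgebra.QuadraticForm

/-! ### The two identifications with the local part of `𝔤`, and the conclusion -/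

section

variable {𝔤 : Type u} [LieRing 𝔤] [LieAlgebra ℂ 𝔤] {𝒢 : ℤ → Submodule ℂ 𝔤}

/-- The local part of a graded Lie algebra. -/
def LocalIdent.ofLocalPart (h𝒢 : IsGradedLieAlgebra 𝒢) : LocalIdent h𝒢.localPart 𝒢 where
  toLin i := (𝒢 i.toInt).subtype
  injective i := (𝒢 i.toInt).injective_subtype
  range_eq i := (𝒢 i.toInt).range_subtype
  map_bracket _ _ _ _ _ _ := rfl

/-- The local Lie algebra `Γ(𝔤₀, B₀, 𝔤₁)` as the local part of `𝔤`. -/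
def LocalIdent.ofTriplet (h𝒢 : IsGradedLieAlgebra 𝒢) (B : h𝒢.localPart.QuadraticForm) :
    LocalIdent B.tripletAlgebra 𝒢 where
  toLin i :=
    { toFun := fun x => (B.ofTripletMap i x).val
      map_add' := fun x y => congrArg Subtype.val (map_add (B.ofTripletMap i) x y)
      map_smul' := fun c x => congrArg Subtype.val (map_smul (B.ofTripletMap i) c x) }
  injective i := Subtype.val_injective.comp (B.ofTripletMap i).injective
  range_eq i := by
    ext x
    constructor
    · rintro ⟨y, rfl⟩
      exact (B.ofTripletMap i y).2
    · intro hx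
      obtain ⟨y, hy⟩ := (B.ofTripletMap i).surjective ⟨x, hx⟩
      exact ⟨y, congrArg Subtype.val hy⟩
  map_bracket i j k h x y := congrArg Subtype.val (B.ofTripletMap_bracket i j k h x y)

end

lemma IsGradedEquiv.symm_trans {𝔤 𝔥 𝔨 : Type u} [LieRing 𝔤] [LieAlgebra ℂ 𝔤] [LieRing 𝔥]
    [LieAlgebra ℂ 𝔥] [LieRing 𝔨] [LieAlgebra ℂ 𝔨] {𝒢 : ℤ → Submodule ℂ 𝔤}
    {ℋ : ℤ → Submodule ℂ 𝔥} {𝒦 : ℤ → Submodule ℂ 𝔨} {e : 𝔤 ≃ₗ⁅ℂ⁆ 𝔥} {e' : 𝔤 ≃ₗ⁅ℂ⁆ 𝔨}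
    (he : IsGradedEquiv 𝒢 ℋ e) (he' : IsGradedEquiv 𝒢 𝒦 e') :
    IsGradedEquiv ℋ 𝒦 (e.symm.trans e') := by
  intro n
  rw [← he n, ← he' n, ← Submodule.map_comp]
  refine congrArg (fun T => Submodule.map T (𝒢 n)) (LinearMap.ext fun x => ?_)
  exact congrArg e' (e.symm_apply_apply x)

end

theorem proposition3 {𝔤 : Type u} [LieRing 𝔤] [LieAlgebra ℂ 𝔤] [FiniteDimensional ℂ 𝔤]
    [LieAlgebra.HasCentralRadical ℂ 𝔤]
    (𝒢 : ℤ → Submodule ℂ 𝔤) (h𝒢 : IsGradedLieAlgebra 𝒢) (B : h𝒢.localPart.QuadraticForm) :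
    (Function.Bijective B.toDualPos ∧
      ∀ (U : h𝒢.localPart.carrier .zero) (Y : h𝒢.localPart.carrier .neg),
        B.toDualPos (h𝒢.localPart.bracket .zero .neg .neg rfl U Y) = ⁅U, B.toDualPos Y⁆) ∧
    ∃ (e₁ : 𝔤 ≃ₗ⁅ℂ⁆ h𝒢.localPart.GMin) (e₂ : h𝒢.localPart.GMin ≃ₗ⁅ℂ⁆ B.tripletAlgebra.GMin),
      IsGradedEquiv 𝒢 h𝒢.localPart.gMinPart e₁ ∧
      (∀ (i : LocDeg) (x : h𝒢.localPart.carrier i), e₁ x.val = h𝒢.localPart.toGMin i x) ∧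
      IsGradedEquiv h𝒢.localPart.gMinPart B.tripletAlgebra.gMinPart e₂ ∧
      (∀ U : h𝒢.localPart.carrier .zero,
        e₂ (h𝒢.localPart.toGMin .zero U) = B.tripletAlgebra.toGMin .zero U) ∧
      (∀ X : h𝒢.localPart.carrier .pos,
        e₂ (h𝒢.localPart.toGMin .pos X) = B.tripletAlgebra.toGMin .pos X) ∧
      (∀ Y : h𝒢.localPart.carrier .neg,
        e₂ (h𝒢.localPart.toGMin .neg Y) = B.tripletAlgebra.toGMin .neg (B.toDualPos Y)) := by
  obtain ⟨e, heg, he⟩ := (LocalIdent.ofLocalPart h𝒢).exists_equiv_gMin h𝒢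
  obtain ⟨e', heg', he'⟩ := (LocalIdent.ofTriplet h𝒢 B).exists_equiv_gMin h𝒢
  have hs : ∀ i x, e.symm (h𝒢.localPart.toGMin i x) = x.val := fun i x => by
    rw [← he i x]
    exact e.symm_apply_apply x.val
  refine ⟨⟨B.toDualPos_bijective, B.toDualPos_bracket⟩, e, e.symm.trans e', heg, he,
    heg.symm_trans heg', fun U => ?_, fun X => ?_, fun Y => ?_⟩
  · rw [LieEquiv.trans_apply, hs]
    exact he' .zero U
  · rw [LieEquiv.trans_apply, hs]
    exact he' .pos X
  · rw [LieEquiv.trans_apply, hs]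
    -- The identification `he'` starts from the dual of `𝔤₁`, so `Y` is first written as the
    -- preimage of `B(Y, ·)`.
    exact (congrArg (fun y : h𝒢.localPart.carrier .neg => e' y.val)
      (B.symm_toDualPos Y).symm).trans (he' .neg (B.toDualPos Y))
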